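/- For a continuous function $f:\mathbb{R}^3\to\mathbb{R}$ and $\lambda\in\mathbb{R}$, say that $f$ is a locally trivial fibration at $\lambda$ if there are a neighborhood $U$ of $\lambda$ and a homeomorphism $\varphi: f^{-1}(\lambda)\times U\to f^{-1}(U)$ such that $f(\varphi(q,u))=u$ for all $(q,u)$. Let $B(f)$ be the set of bifurcation values of $f$, that is, of those $\lambda\in\mathbb{R}$ at which $f$ is not a locally trivial fibration. Let $p(x)=(x-3)^2(x-2)(x-1)^2$ and let $f:\mathbb{R}^3\to\mathbb{R}$ be given by $f(x,y,z)=y-p\bigl(x(y^2+z^2)\bigr)$. Then: 1. $f$ is a polynomial function and a submersion, i.e. its differential is surjective at every point of $\mathbb{R}^3$. 2. There is $\varepsilon>0$ such that for every $t\in(-\varepsilon,\varepsilon)$ the fiber $f^{-1}(t)$ is connected and diffeomorphic to $\mathbb{R}^2$ minus $3$ points, i.e. to $\mathbb{R}^2\setminus S$ for every $S\subset\mathbb{R}^2$ with exactly three elements. 3. Nevertheless $0\in B(f)$, i.e. $f$ is not a locally trivial fibration at $0$. Consequently the following question of Joiţa and Tibăr has a negative answer: if $g:\mathbb{R}^3\to\mathbb{R}$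 is a polynomial function with a regular value $\lambda$ (the differential of $g$ is surjective at every point of $g^{-1}(\lambda)$), and if the fibers $g^{-1}(t)$ are connected and have constant Euler characteristic for all $t$ near $\lambda$, does it follow that $\lambda\notin B(g)$? Here the Euler characteristic of a fiber $X$ is $\sum_i(-1)^i\dim H_i(X;\mathbb{Q})$. -/

import Mathlib

open Set Filter Topology
open scoped ContDiff

/-- Euclidean space `ℝⁿ`. -/
abbrev Euc (n : ℕ) : Type := EuclideanSpace ℝ (Fin n)

/-- `g : ℝⁿ → ℝ` is a polynomial function. -/
def IsPolynomialFunction {n : ℕ} (g : Euc n → ℝ) : Prop :=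
  ∃ P : MvPolynomial (Fin n) ℝ, ∀ v : Euc n, g v = MvPolynomial.eval (fun i => v i) P

/-- `g` is differentiable at `v` with surjective differential. -/
def IsRegularPoint {n : ℕ} (g : Euc n → ℝ) (v : Euc n) : Prop :=
  DifferentiableAt ℝ g v ∧ Function.Surjective (fderiv ℝ g v)

/-- `g` is a smooth submersion: it is smooth and its differential is surjective at every point. -/
def IsSubmersionFunction {n : ℕ} (g : Euc n → ℝ) : Prop :=
  ContDiff ℝ ∞ g ∧ ∀ v : Euc n, IsRegularPoint g v

/-- `c` is a regular value of `g`: every point of the fiber over `c` is a regular point. -/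
def IsRegularValue {n : ℕ} (g : Euc n → ℝ) (c : ℝ) : Prop :=
  ∀ v : Euc n, g v = c → IsRegularPoint g v

/-- `g` is a locally trivial fibration at `c`: for some neighborhood `U` of `c` there is a
homeomorphism `g⁻¹(c) × U ≃ g⁻¹(U)` that carries the second projection to `g`. -/
def IsLocallyTrivialFibrationAt {X Y : Type*} [TopologicalSpace X] [TopologicalSpace Y]
    (g : X → Y) (c : Y) : Prop :=
  ∃ U ∈ 𝓝 c, ∃ φ : (g ⁻¹' {c} : Set X) × U ≃ₜ (g ⁻¹' U : Set X),
    ∀ q : (g ⁻¹' {c} : Set X) × U, g (φ q : X) = (q.2 : Y)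

/-- The set `B(g)` of bifurcation values of `g`. -/
def bifurcationSet {X Y : Type*} [TopologicalSpace X] [TopologicalSpace Y]
    (g : X → Y) : Set Y :=
  {c | ¬ IsLocallyTrivialFibrationAt g c}

/-- `g` is smooth on an arbitrary subset `A` of `ℝᵐ`: near each point of `A` it agrees on `A` with
a smooth map defined on an open set of `ℝᵐ`. On an embedded submanifold `A` this
is smoothness in the sense of manifolds. -/
def SmoothOnSubset {m n : ℕ} (g : Euc m → Euc n) (A : Set (Euc m)) : Prop :=
  ∀ a ∈ A, ∃ U : Set (Euc m), IsOpen U ∧ a ∈ U ∧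
    ∃ G : Euc m → Euc n, ContDiffOn ℝ ∞ G U ∧ EqOn G g (U ∩ A)

/-- The subsets `A ⊆ ℝᵐ` and `B ⊆ ℝⁿ` are diffeomorphic: there are mutually inverse bijections
between them which are both smooth. -/
def AreDiffeomorphic {m n : ℕ} (A : Set (Euc m)) (B : Set (Euc n)) : Prop :=
  ∃ (g : Euc m → Euc n) (h : Euc n → Euc m),
    MapsTo g A B ∧ MapsTo h B A ∧ LeftInvOn h g A ∧ RightInvOn h g B ∧
      SmoothOnSubset g A ∧ SmoothOnSubset h B

/-- The Euler characteristic `∑ᵢ (-1)ⁱ dim Hᵢ(X; ℚ)` through singular homology. It is only used for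
fibers of polynomial functions on `ℝ³`; these are real algebraic sets, so their total rational
homology is finite-dimensional and no default value enters. -/
noncomputable def eulerCharacteristic (X : Type) [TopologicalSpace X] : ℤ :=
  HomologicalComplex.homologyEulerChar
    (((AlgebraicTopology.singularChainComplexFunctor (ModuleCat.{0} ℚ)).obj
      (ModuleCat.of ℚ ℚ)).obj (TopCat.of X))

/-- The polynomial `p(x) = (x - 3)² (x - 2) (x - 1)²`. -/
def pPoly (x : ℝ) : ℝ := (x - 3) ^ 2 * (x - 2) * (x - 1) ^ 2

/-- The function `f(x, y, z) = y - p(x (y² + z²))` on `ℝ³`. -/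
def fMain (v : Euc 3) : ℝ := v 1 - pPoly (v 0 * (v 1 ^ 2 + v 2 ^ 2))

/-! Put `u = x (y² + z²)`. On the fiber over `t` one has `y = t + p(u)`, and `x = u / (y² + z²)` is
recovered from `(u, z)` unless `y = z = 0`, which happens only for `t = -p(0) = 18`. So for `t ≠ 18`
the fiber is the `(u, z)`-plane without the points `(r, 0)` with `p(r) = -t`
(`areDiffeomorphic_fMain_fiber`). For `|t| < 1/4` there are three such `r`, and complements of three
points are all diffeomorphic by polynomial shears (`areDiffeomorphic_compl_of_ncard_eq`).

The number of punctures is constant, but their positions jump at `t = 0`: the double roots `1` and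
`3` of `p` each split into two roots or disappear, according to the sign of `t`. For `t < 0` no
puncture is left near `u = 1`, so a loop around `(1, 0)` in the zero fiber bounds a disc running
through fibers with `t < 0`. A trivialization at `0` would retract this disc into the zero fiber
without moving the loop. The function `(u - 1) + iz` would then be nonvanishing on the disc and have
winding number one on its boundary, contrary to `exists_norm_eq_one_ne_mul_of_continuous`. -/

/-! ### The winding number obstruction -/

/-- A nonvanishing continuous function on the plane cannot restrict to a multiple of the identity
on the unit circle. -/
theorem exists_norm_eq_one_ne_mul_of_continuous {F : ℂ → ℂ} (hF : Continuous F)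
    (hF0 : ∀ w, F w ≠ 0) (c : ℂ) : ∃ w : ℂ, ‖w‖ = 1 ∧ F w ≠ c * w := by
  by_contra! hc
  have hU : IsSimplyConnected (univ : Set ℂ) := by
    have := (convex_univ (𝕜 := ℝ) (E := ℂ)).contractibleSpace univ_nonempty
    exact SimplyConnectedSpace.ofContractible _
  obtain ⟨G, hG, hGF⟩ := Complex.exists_continuousOn_eqOn_exp_comp (U := (univ : Set ℂ))
    hU isOpen_univ hF.continuousOn
    (by rintro ⟨w, -, hw⟩; exact hF0 w hw)
  rw [continuousOn_univ] at hG
  have key (θ : ℝ) : Complex.exp (G (Complex.exp (θ * Complex.I)))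
      = c * Complex.exp (θ * Complex.I) :=
    (hGF (mem_univ _)).trans (hc _ (Complex.norm_exp_ofReal_mul_I θ))
  have h1 := key 0
  simp only [Complex.ofReal_zero, zero_mul, Complex.exp_zero, mul_one] at h1
  -- Both functions lift the same path through the exponential covering and agree at `θ = 0`. The
  -- first is `2π`-periodic and the second is not.
  have heq := Complex.isCoveringMap_exp.eq_of_comp_eq
    (g₁ := fun θ : ℝ => G (Complex.exp (θ * Complex.I)))
    (g₂ := fun θ : ℝ => G 1 + θ * Complex.I) (by fun_prop) (by fun_prop)
    (by
      ext θ
      simp only [Function.comp_apply, key, Complex.exp_add, h1])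
    0 (by simp)
  have h2 := congrFun heq (2 * Real.pi)
  simp at h2

/-! ### Diffeomorphic subsets and homeomorphism invariance -/

theorem SmoothOnSubset.of_contDiffOn {m n : ℕ} {g : Euc m → Euc n} {A U : Set (Euc m)}
    (hU : IsOpen U) (hAU : A ⊆ U) (hg : ContDiffOn ℝ ∞ g U) : SmoothOnSubset g A :=
  fun _ ha => ⟨U, hU, hAU ha, g, hg, fun _ _ => rfl⟩

theorem SmoothOnSubset.of_contDiff {m n : ℕ} {g : Euc m → Euc n} (hg : ContDiff ℝ ∞ g)
    (A : Set (Euc m)) : SmoothOnSubset g A :=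
  .of_contDiffOn isOpen_univ (subset_univ A) hg.contDiffOn

theorem SmoothOnSubset.comp {l m n : ℕ} {h : Euc m → Euc n} {g : Euc l → Euc m}
    {A : Set (Euc l)} {B : Set (Euc m)} (hh : SmoothOnSubset h B) (hg : SmoothOnSubset g A)
    (hAB : MapsTo g A B) : SmoothOnSubset (h ∘ g) A := by
  intro a ha
  obtain ⟨U, hU, haU, G, hG, hGg⟩ := hg a ha
  obtain ⟨V, hV, haV, H, hH, hHh⟩ := hh (g a) (hAB ha)
  refine ⟨U ∩ G ⁻¹' V, hG.continuousOn.isOpen_inter_preimage hU hV,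
    ⟨haU, by rwa [mem_preimage, hGg ⟨haU, ha⟩]⟩, H ∘ G,
    hH.comp (hG.mono inter_subset_left) fun _ hx => hx.2, ?_⟩
  rintro x ⟨⟨hxU, hxV⟩, hxA⟩
  have hx := hGg ⟨hxU, hxA⟩
  rw [Function.comp_apply, Function.comp_apply, hx]
  exact hHh ⟨by rwa [mem_preimage, hx] at hxV, hAB hxA⟩

theorem SmoothOnSubset.continuousOn {m n : ℕ} {g : Euc m → Euc n} {A : Set (Euc m)}
    (hg : SmoothOnSubset g A) : ContinuousOn g A := by
  intro a ha
  obtain ⟨U, hU, haU, G, hG, hGg⟩ := hg a ha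
  have h1 : ContinuousWithinAt g (U ∩ A) a :=
    ((hG.continuousOn a haU).mono inter_subset_left).congr (fun x hx => (hGg hx).symm)
      (hGg ⟨haU, ha⟩).symm
  rw [inter_comm] at h1
  exact (continuousWithinAt_inter (hU.mem_nhds haU)).1 h1

theorem AreDiffeomorphic.symm {m n : ℕ} {A : Set (Euc m)} {B : Set (Euc n)}
    (h : AreDiffeomorphic A B) : AreDiffeomorphic B A := by
  obtain ⟨g, h, hg, hh, hl, hr, hgs, hhs⟩ := h
  exact ⟨h, g, hh, hg, hr, hl, hhs, hgs⟩

theorem AreDiffeomorphic.trans {l m n : ℕ} {A : Set (Euc l)} {B : Set (Euc m)} {C : Set (Euc n)}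
    (h₁ : AreDiffeomorphic A B) (h₂ : AreDiffeomorphic B C) : AreDiffeomorphic A C := by
  obtain ⟨g, h, hg, hh, hl, hr, hgs, hhs⟩ := h₁
  obtain ⟨g', h', hg', hh', hl', hr', hgs', hhs'⟩ := h₂
  exact ⟨g' ∘ g, h ∘ h', hg'.comp hg, hh.comp hh', hl.comp hl' hg, LeftInvOn.comp hr' hr hh',
    hgs'.comp hgs hg, hhs.comp hhs' hh'⟩

theorem AreDiffeomorphic.of_inverse {n : ℕ} {g h : Euc n → Euc n} (hg : ContDiff ℝ ∞ g)
    (hh : ContDiff ℝ ∞ h) (hl : Function.LeftInverse h g) (hr : Function.RightInverse h g)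
    (T : Set (Euc n)) : AreDiffeomorphic Tᶜ (g '' T)ᶜ := by
  refine ⟨g, h, fun x hx ⟨y, hy, hyx⟩ => hx (hl.injective hyx ▸ hy),
    fun x hx hT => hx ⟨h x, hT, hr x⟩, fun x _ => hl x, fun x _ => hr x,
    .of_contDiff hg _, .of_contDiff hh _⟩

theorem AreDiffeomorphic.nonempty_homeomorph {m n : ℕ} {A : Set (Euc m)} {B : Set (Euc n)}
    (h : AreDiffeomorphic A B) : Nonempty (A ≃ₜ B) := by
  obtain ⟨g, h, hg, hh, hl, hr, hgs, hhs⟩ := h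
  exact ⟨{ toFun := hg.restrict
           invFun := hh.restrict
           left_inv := fun x => Subtype.ext (hl x.2)
           right_inv := fun x => Subtype.ext (hr x.2)
           continuous_toFun := hgs.continuousOn.mapsToRestrict hg
           continuous_invFun := hhs.continuousOn.mapsToRestrict hh }⟩

theorem eulerCharacteristic_eq_of_homeomorph {X Y : Type} [TopologicalSpace X]
    [TopologicalSpace Y] (e : X ≃ₜ Y) : eulerCharacteristic X = eulerCharacteristic Y := by
  unfold eulerCharacteristic HomologicalComplex.homologyEulerChar GradedObject.eulerChar
  refine finsum_congr fun i => ?_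
  have e' := (HomologicalComplex.homologyFunctor _ _ i).mapIso
    (((AlgebraicTopology.singularChainComplexFunctor (ModuleCat.{0} ℚ)).obj
      (ModuleCat.of ℚ ℚ)).mapIso (TopCat.isoOfHomeo (X := TopCat.of X) (Y := TopCat.of Y) e))
  exact congrArg _ (congrArg _ e'.toLinearEquiv.finrank_eq)

/-! ### Moving finite subsets of the plane by shears -/

/-- The shear `(x, y) ↦ (x, y + q(x))`. -/
noncomputable def verticalShear (q : Polynomial ℝ) (v : Euc 2) : Euc 2 :=
  !₂[v 0, v 1 + q.eval (v 0)]

/-- The shear `(x, y) ↦ (x + q(y), y)`. -/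
noncomputable def horizontalShear (q : Polynomial ℝ) (v : Euc 2) : Euc 2 :=
  !₂[v 0 + q.eval (v 1), v 1]

theorem contDiff_verticalShear (q : Polynomial ℝ) : ContDiff ℝ ∞ (verticalShear q) := by
  rw [contDiff_euclidean]
  intro i
  have h := q.contDiff_aeval (𝕜 := ℝ) ∞
  simp only [Polynomial.coe_aeval_eq_eval] at h
  fin_cases i <;> simp only [verticalShear] <;> simp <;> fun_prop

theorem contDiff_horizontalShear (q : Polynomial ℝ) : ContDiff ℝ ∞ (horizontalShear q) := by
  rw [contDiff_euclidean]
  intro i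
  have h := q.contDiff_aeval (𝕜 := ℝ) ∞
  simp only [Polynomial.coe_aeval_eq_eval] at h
  fin_cases i <;> simp only [horizontalShear] <;> simp <;> fun_prop

theorem verticalShear_neg (q : Polynomial ℝ) (v : Euc 2) :
    verticalShear (-q) (verticalShear q v) = v := by
  ext i; fin_cases i <;> simp [verticalShear]

theorem horizontalShear_neg (q : Polynomial ℝ) (v : Euc 2) :
    horizontalShear (-q) (horizontalShear q v) = v := by
  ext i; fin_cases i <;> simp [horizontalShear]

theorem areDiffeomorphic_compl_image_verticalShear (q : Polynomial ℝ) (T : Set (Euc 2)) :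
    AreDiffeomorphic Tᶜ (verticalShear q '' T)ᶜ :=
  .of_inverse (contDiff_verticalShear q) (contDiff_verticalShear (-q)) (verticalShear_neg q)
    (fun v => by simpa using verticalShear_neg (-q) v) T

theorem areDiffeomorphic_compl_image_horizontalShear (q : Polynomial ℝ) (T : Set (Euc 2)) :
    AreDiffeomorphic Tᶜ (horizontalShear q '' T)ᶜ :=
  .of_inverse (contDiff_horizontalShear q) (contDiff_horizontalShear (-q)) (horizontalShear_neg q)
    (fun v => by simpa using horizontalShear_neg (-q) v) T

/-- Finitely many points of the plane have distinct first coordinates after a linear shear. -/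
theorem exists_injective_add_mul {n : ℕ} {P : Fin n → Euc 2} (hP : Function.Injective P) :
    ∃ c : ℝ, Function.Injective fun i => P i 0 + c * P i 1 := by
  -- These are the slopes for which two points collide. Pairs with equal second coordinates
  -- contribute the junk value `0`, which only excludes one more slope.
  have hfin : (range fun ij : Fin n × Fin n =>
      -(P ij.1 0 - P ij.2 0) / (P ij.1 1 - P ij.2 1)).Finite := finite_range _
  obtain ⟨c, hc⟩ := hfin.infinite_compl.nonempty
  refine ⟨c, fun i j hij => ?_⟩
  by_contra hne
  simp only at hij
  by_cases h1 : P i 1 = P j 1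
  · refine hne (hP ?_)
    ext k
    fin_cases k
    · simpa [h1] using hij
    · exact h1
  · refine hc ⟨(i, j), ?_⟩
    have := sub_ne_zero.2 h1
    field_simp
    linarith

/-- The complement of `n` points in the plane is diffeomorphic to that of
`(0, 0), …, (0, n - 1)`. -/
theorem areDiffeomorphic_compl_range {n : ℕ} {P : Fin n → Euc 2} (hP : Function.Injective P) :
    AreDiffeomorphic (range P)ᶜ (range fun i : Fin n => (!₂[0, (i : ℝ)] : Euc 2))ᶜ := by
  obtain ⟨c, hc⟩ := exists_injective_add_mul hP
  set a : Fin n → ℝ := fun i => P i 0 + c * P i 1 with ha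
  -- The first shear makes the abscissas `a i` distinct. Interpolation at them then moves the `i`-th
  -- point to height `i`, and interpolation at these distinct heights moves every abscissa to `0`.
  let q₁ : Polynomial ℝ := Polynomial.C c * Polynomial.X
  let q₂ := Lagrange.interpolate Finset.univ a fun i => (i : ℝ) - P i 1
  let q₃ := Lagrange.interpolate Finset.univ (fun i : Fin n => (i : ℝ)) fun i => -a i
  have h₂ (i : Fin n) : q₂.eval (a i) = (i : ℝ) - P i 1 :=
    Lagrange.eval_interpolate_at_node _ hc.injOn (Finset.mem_univ i)
  have h₃ (i : Fin n) : q₃.eval (i : ℝ) = -a i :=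
    Lagrange.eval_interpolate_at_node (v := fun i : Fin n => (i : ℝ)) _
      (fun i _ j _ hij => Fin.ext (Nat.cast_injective hij)) (Finset.mem_univ i)
  have h := ((areDiffeomorphic_compl_image_horizontalShear q₁ (range P)).trans
    (areDiffeomorphic_compl_image_verticalShear q₂ _)).trans
    (areDiffeomorphic_compl_image_horizontalShear q₃ _)
  rw [← range_comp, ← range_comp, ← range_comp] at h
  convert! h using 3
  ext i k
  have e₁ : horizontalShear q₁ (P i) = !₂[a i, P i 1] := by
    simp [horizontalShear, q₁, ha]
  have e₂ : verticalShear q₂ !₂[a i, P i 1] = !₂[a i, (i : ℝ)] := by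
    simp [verticalShear, h₂]
  have e₃ : horizontalShear q₃ !₂[a i, (i : ℝ)] = !₂[0, (i : ℝ)] := by
    simp [horizontalShear, h₃]
  simp only [Function.comp_apply, e₁, e₂, e₃]

theorem Set.exists_injective_range_eq_of_ncard_eq {α : Type*} {S : Set α} {n : ℕ}
    (hS : S.ncard = n) (hn : n ≠ 0) : ∃ P : Fin n → α, Function.Injective P ∧ range P = S := by
  have : Finite S := finite_of_ncard_ne_zero (hS ▸ hn)
  subst hS
  have e : Fin S.ncard ≃ S := (Finite.equivFinOfCardEq (Nat.card_coe_set_eq S)).symm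
  exact ⟨fun i => e i, Subtype.val_injective.comp e.injective, by
    rw [range_comp' Subtype.val e, e.range_eq_univ, image_univ, Subtype.range_coe]⟩

theorem areDiffeomorphic_compl_of_ncard_eq {S T : Set (Euc 2)} {n : ℕ} (hn : n ≠ 0)
    (hS : S.ncard = n) (hT : T.ncard = n) : AreDiffeomorphic Sᶜ Tᶜ := by
  obtain ⟨P, hP, rfl⟩ := exists_injective_range_eq_of_ncard_eq hS hn
  obtain ⟨Q, hQ, rfl⟩ := exists_injective_range_eq_of_ncard_eq hT hn
  exact (areDiffeomorphic_compl_range hP).trans (areDiffeomorphic_compl_range hQ).symm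

/-! ### Counting the solutions of `p(u) = c` for small `c` -/

theorem pPoly_two_add (s : ℝ) : pPoly (2 + s) = s * (s ^ 2 - 1) ^ 2 := by
  unfold pPoly; ring

theorem hasDerivAt_mul_sq_sub_one_sq (s : ℝ) :
    HasDerivAt (fun s : ℝ => s * (s ^ 2 - 1) ^ 2) ((s ^ 2 - 1) * (5 * s ^ 2 - 1)) s := by
  have h := (hasDerivAt_id' s).mul ((((hasDerivAt_id' s).pow 2).sub_const 1).pow 2)
  convert! h using 1
  simp
  ring

/-- For small `c > 0` the equation `s (s² - 1)² = c` has exactly three real solutions. -/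
theorem ncard_mul_sq_sub_one_sq_eq_of_pos {c : ℝ} (h0 : 0 < c) (h1 : c < 1 / 4) :
    {s : ℝ | s * (s ^ 2 - 1) ^ 2 = c}.ncard = 3 := by
  set h : ℝ → ℝ := fun s => s * (s ^ 2 - 1) ^ 2 with hh
  have hd (s : ℝ) : deriv h s = (s ^ 2 - 1) * (5 * s ^ 2 - 1) :=
    (hasDerivAt_mul_sq_sub_one_sq s).deriv
  have hc : Continuous h := by fun_prop
  -- `α` is the only critical point of `h` in `(0, 1)`. The three monotone branches on `[0, α]`,
  -- `[α, 1]` and `[1, ∞)` carry one solution each.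
  set α : ℝ := √(1 / 5) with hα
  have hα2 : α ^ 2 = 1 / 5 := Real.sq_sqrt (by norm_num)
  have hα0 : 0 < α := Real.sqrt_pos.2 (by norm_num)
  have hα1 : α < 1 := by nlinarith
  have hαc : c < h α := by
    -- Since `h α = (16 / 25) α`, this bound is exactly `h α > 1 / 4`.
    have : (25 : ℝ) / 64 < α := by
      by_contra! hlt
      nlinarith
    simp only [hh, hα2]
    linarith
  have m₁ : StrictMonoOn h (Icc 0 α) := by
    refine strictMonoOn_of_deriv_pos (convex_Icc 0 α) hc.continuousOn fun s hs => ?_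
    rw [interior_Icc] at hs
    obtain ⟨a, b⟩ := hs
    rw [hd]
    have : s ^ 2 < α ^ 2 := by gcongr
    exact mul_pos_of_neg_of_neg (by linarith) (by linarith)
  have m₂ : StrictAntiOn h (Icc α 1) := by
    refine strictAntiOn_of_deriv_neg (convex_Icc α 1) hc.continuousOn fun s hs => ?_
    rw [interior_Icc] at hs
    obtain ⟨a, b⟩ := hs
    rw [hd]
    have : α ^ 2 < s ^ 2 := by gcongr
    exact mul_neg_of_neg_of_pos (by nlinarith) (by linarith)
  have m₃ : StrictMonoOn h (Ici 1) := by
    refine strictMonoOn_of_deriv_pos (convex_Ici 1) hc.continuousOn fun s hs => ?_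
    rw [interior_Ici, mem_Ioi] at hs
    rw [hd]
    exact mul_pos (by nlinarith) (by nlinarith)
  obtain ⟨a, ha, hac⟩ := intermediate_value_Ioo hα0.le hc.continuousOn
    (show c ∈ Ioo (h 0) (h α) from ⟨by simpa [hh] using h0, hαc⟩)
  obtain ⟨b, hb, hbc⟩ := intermediate_value_Ioo' hα1.le hc.continuousOn
    (show c ∈ Ioo (h 1) (h α) from ⟨by simpa [hh] using h0, hαc⟩)
  obtain ⟨d, hd, hdc⟩ := intermediate_value_Ioo (by norm_num : (1 : ℝ) ≤ 2) hc.continuousOn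
    (show c ∈ Ioo (h 1) (h 2) from ⟨by simpa [hh] using h0, by norm_num [hh]; linarith⟩)
  have hset : {s : ℝ | s * (s ^ 2 - 1) ^ 2 = c} = {a, b, d} := by
    ext s
    simp only [mem_ofPred_eq, mem_insert_iff, mem_singleton_iff]
    constructor
    · intro (hs : h s = c)
      have hs0 : 0 ≤ s := by
        by_contra! hneg
        have : h s ≤ 0 := mul_nonpos_of_nonpos_of_nonneg hneg.le (sq_nonneg _)
        linarith
      rcases le_total s α with h2 | h2
      · exact .inl (m₁.injOn ⟨hs0, h2⟩ ⟨ha.1.le, ha.2.le⟩ (hs.trans hac.symm))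
      rcases le_total s 1 with h3 | h3
      · exact .inr (.inl (m₂.injOn ⟨h2, h3⟩ ⟨hb.1.le, hb.2.le⟩ (hs.trans hbc.symm)))
      · exact .inr (.inr (m₃.injOn h3 hd.1.le (hs.trans hdc.symm)))
    · rintro (rfl | rfl | rfl) <;> assumption
  have hab : a < b := ha.2.trans hb.1
  have hbd : b < d := hb.2.trans hd.1
  rw [hset]
  exact ncard_eq_three.2 ⟨a, b, d, hab.ne, (hab.trans hbd).ne, hbd.ne, rfl⟩

/-- The quintic is odd, which reduces negative `c` to positive `c`. At `c = 0` the distinct roots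
are `0` and the double roots `±1`. -/
theorem ncard_mul_sq_sub_one_sq_eq {c : ℝ} (hc : |c| < 1 / 4) :
    {s : ℝ | s * (s ^ 2 - 1) ^ 2 = c}.ncard = 3 := by
  rw [abs_lt] at hc
  rcases lt_trichotomy c 0 with h | rfl | h
  · rw [← ncard_mul_sq_sub_one_sq_eq_of_pos (neg_pos.2 h) (by linarith),
      ← ncard_image_of_injective _ neg_injective, image_neg_eq_neg]
    congr 1
    ext s
    simp only [Set.mem_neg, mem_ofPred_eq, neg_sq, neg_mul, neg_eq_iff_eq_neg]
  · refine ncard_eq_three.2 ⟨-1, 0, 1, by norm_num, by norm_num, by norm_num, ?_⟩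
    ext s
    have h1 : s ^ 2 = 1 ↔ s = 1 ∨ s = -1 := by simp
    rw [mem_ofPred_eq, mul_eq_zero, sq_eq_zero_iff, sub_eq_zero, h1]
    simp only [mem_insert_iff, mem_singleton_iff]
    tauto
  · exact ncard_mul_sq_sub_one_sq_eq_of_pos h hc.2

theorem ncard_pPoly_eq {c : ℝ} (hc : |c| < 1 / 4) : {u : ℝ | pPoly u = c}.ncard = 3 := by
  rw [← ncard_mul_sq_sub_one_sq_eq hc,
    ← ncard_image_of_injective {s : ℝ | s * (s ^ 2 - 1) ^ 2 = c} (add_right_injective (2 : ℝ))]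
  congr 1
  ext u
  simp only [mem_ofPred_eq, mem_image]
  constructor
  · intro h
    exact ⟨u - 2, by rw [← pPoly_two_add, add_sub_cancel, h], by ring⟩
  · rintro ⟨s, hs, rfl⟩
    rw [pPoly_two_add, hs]

/-! ### Regularity of `f` -/

theorem contDiff_pPoly : ContDiff ℝ ∞ pPoly := by unfold pPoly; fun_prop

theorem isPolynomialFunction_fMain : IsPolynomialFunction fMain := by
  open MvPolynomial in
  let u : MvPolynomial (Fin 3) ℝ := X 0 * (X 1 ^ 2 + X 2 ^ 2)
  refine ⟨MvPolynomial.X 1 - (u - 3) ^ 2 * (u - 2) * (u - 1) ^ 2, fun v => ?_⟩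
  simp [u, fMain, pPoly]

theorem contDiff_fMain : ContDiff ℝ ∞ fMain := by unfold fMain pPoly; fun_prop

/-- The `x`-derivative is `-p'(u) (y² + z²)`. If it vanishes, then `p'(u) = 0` or `y = 0`, and in
both cases the `y`-derivative `1 - 2xy p'(u)` equals `1`. -/
theorem isSubmersionFunction_fMain : IsSubmersionFunction fMain := by
  refine ⟨contDiff_fMain, fun v => ?_⟩
  have hd : DifferentiableAt ℝ fMain v := contDiff_fMain.differentiable (by simp) v
  refine ⟨hd, ?_⟩
  have hline (w : Euc 3) : HasDerivAt (fun s : ℝ => fMain (v + s • w)) (fderiv ℝ fMain v w) 0 := by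
    have hl : HasDerivAt (fun s : ℝ => v + s • w) w 0 := by
      simpa using ((hasDerivAt_id (0 : ℝ)).smul_const w).const_add v
    have := HasFDerivAt.comp_hasDerivAt (0 : ℝ) (by simpa using hd.hasFDerivAt) hl
    exact this
  have hp (y : ℝ) : HasDerivAt pPoly (deriv pPoly y) y :=
    (contDiff_pPoly.differentiable (by simp) y).hasDerivAt
  set u := v 0 * (v 1 ^ 2 + v 2 ^ 2) with hu
  have h0 : fderiv ℝ fMain v (EuclideanSpace.single 0 1)
      = -(deriv pPoly u * (v 1 ^ 2 + v 2 ^ 2)) := by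
    refine (hline _).unique ?_
    have h2 : HasDerivAt (fun s : ℝ => (v 0 + s) * (v 1 ^ 2 + v 2 ^ 2)) (v 1 ^ 2 + v 2 ^ 2) 0 := by
      simpa using ((hasDerivAt_id' (0 : ℝ)).const_add (v 0)).mul_const (v 1 ^ 2 + v 2 ^ 2)
    have h3 := (HasDerivAt.comp (0 : ℝ) (h₂ := pPoly) (by rw [add_zero]; exact hp u) h2).const_sub (v 1)
    refine h3.congr_of_eventuallyEq (.of_forall fun s => ?_)
    simp [fMain]
  have h1 : fderiv ℝ fMain v (EuclideanSpace.single 1 1)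
      = 1 - deriv pPoly u * (v 0 * (2 * v 1)) := by
    refine (hline _).unique ?_
    have h2 : HasDerivAt (fun s : ℝ => v 0 * ((v 1 + s) ^ 2 + v 2 ^ 2)) (v 0 * (2 * v 1)) 0 := by
      simpa using ((((hasDerivAt_id' (0 : ℝ)).const_add (v 1)).pow 2).add_const
        (v 2 ^ 2)).const_mul (v 0)
    have h3 := ((hasDerivAt_id' (0 : ℝ)).const_add (v 1)).sub
      (HasDerivAt.comp (0 : ℝ) (h₂ := pPoly) (by rw [add_zero]; exact hp u) h2)
    refine h3.congr_of_eventuallyEq (.of_forall fun s => ?_)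
    simp [fMain]
  have hne : fderiv ℝ fMain v ≠ 0 := by
    intro hz
    rw [hz, zero_apply] at h0 h1
    rcases mul_eq_zero.1 (neg_eq_zero.1 h0.symm) with h | h
    · simp [h] at h1
    · have : v 1 = 0 := by nlinarith [sq_nonneg (v 1), sq_nonneg (v 2)]
      simp [this] at h1
  exact LinearMap.surjective (f := (fderiv ℝ fMain v).toLinearMap) fun h =>
    hne (ContinuousLinearMap.coe_injective h)

/-! ### The fibers of `f` as punctured planes -/

/-- The axis `y = z = 0` lies in the fiber over `-p(0) = 18`. -/
theorem sq_add_sq_pos_of_fMain_ne {v : Euc 3} (h : fMain v ≠ 18) : 0 < v 1 ^ 2 + v 2 ^ 2 := by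
  by_contra! hle
  have h1 : v 1 = 0 := by nlinarith [sq_nonneg (v 1), sq_nonneg (v 2)]
  have h2 : v 2 = 0 := by nlinarith [sq_nonneg (v 1), sq_nonneg (v 2)]
  exact h (by norm_num [fMain, pPoly, h1, h2])

/-- The part `(y, z) ≠ 0` of the fiber of `fMain` over `t`, in the coordinates
`u = x (y² + z²)` and `z`. -/
noncomputable def fiberChart (t : ℝ) (w : Euc 2) : Euc 3 :=
  !₂[w 0 / ((t + pPoly (w 0)) ^ 2 + w 1 ^ 2), t + pPoly (w 0), w 1]

theorem fMain_fiberChart {t : ℝ} {w : Euc 2} (h : (t + pPoly (w 0)) ^ 2 + w 1 ^ 2 ≠ 0) :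
    fMain (fiberChart t w) = t := by
  simp [fMain, fiberChart, div_mul_cancel₀ _ h]

theorem areDiffeomorphic_fMain_fiber {t : ℝ} (ht : t ≠ 18) :
    AreDiffeomorphic (fMain ⁻¹' {t})
      {w : Euc 2 | (t + pPoly (w 0)) ^ 2 + w 1 ^ 2 ≠ 0} := by
  have key {v : Euc 3} (hv : fMain v = t) :
      t + pPoly (v 0 * (v 1 ^ 2 + v 2 ^ 2)) = v 1 := by
    rw [← hv, fMain]; ring
  refine ⟨fun v => !₂[v 0 * (v 1 ^ 2 + v 2 ^ 2), v 2], fiberChart t, ?_, ?_, ?_, ?_, ?_, ?_⟩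
  · intro v hv
    have := sq_add_sq_pos_of_fMain_ne (v := v) (by rwa [show fMain v = t from hv])
    simpa [key hv] using this.ne'
  · intro w hw
    exact fMain_fiberChart hw
  · intro v hv
    have := sq_add_sq_pos_of_fMain_ne (v := v) (by rwa [show fMain v = t from hv])
    ext i
    fin_cases i
    · simp [fiberChart, key hv, this.ne']
    · simpa [fiberChart] using key hv
    · simp [fiberChart]
  · intro w hw
    ext i
    fin_cases i
    · simp [fiberChart, div_mul_cancel₀ _ hw]
    · simp [fiberChart]
  · refine .of_contDiff (contDiff_euclidean.2 fun i => ?_) _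
    fin_cases i <;> simp <;> fun_prop
  · have hp := contDiff_pPoly
    have hcont := hp.continuous
    have ho : IsOpen {w : Euc 2 | (t + pPoly (w 0)) ^ 2 + w 1 ^ 2 ≠ 0} :=
      isOpen_ne_fun (by fun_prop) continuous_const
    refine .of_contDiffOn ho Subset.rfl (contDiffOn_euclidean.2 fun i => ?_)
    fin_cases i
    · simp only [fiberChart]
      simp
      exact ContDiffOn.div (by fun_prop) (by fun_prop) fun w hw => hw
    · simp only [fiberChart]; simp; fun_prop
    · simp only [fiberChart]; simp; fun_prop

theorem areDiffeomorphic_fMain_fiber_compl {t : ℝ} (ht : |t| < 1 / 4) {S : Set (Euc 2)}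
    (hS : S.ncard = 3) : AreDiffeomorphic (fMain ⁻¹' {t}) Sᶜ := by
  have ht18 : t ≠ 18 := by rintro rfl; norm_num at ht
  refine (areDiffeomorphic_fMain_fiber ht18).trans ?_
  have himg : {w : Euc 2 | (t + pPoly (w 0)) ^ 2 + w 1 ^ 2 ≠ 0}
      = ((fun u : ℝ => (!₂[u, 0] : Euc 2)) '' {u | pPoly u = -t})ᶜ := by
    ext w
    rw [mem_ofPred_eq, mem_compl_iff, not_iff_not]
    constructor
    · intro h
      have h1 : t + pPoly (w 0) = 0 := by nlinarith [sq_nonneg (t + pPoly (w 0)), sq_nonneg (w 1)]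
      have h2 : w 1 = 0 := by nlinarith [sq_nonneg (t + pPoly (w 0)), sq_nonneg (w 1)]
      refine ⟨w 0, by simp only [mem_ofPred_eq]; linarith, ?_⟩
      ext i
      fin_cases i
      · simp
      · simp [h2]
    · rintro ⟨u, hu, rfl⟩
      simp only [mem_ofPred_eq] at hu
      simp [hu]
  rw [himg]
  refine areDiffeomorphic_compl_of_ncard_eq three_ne_zero ?_ hS
  have hinj : Function.Injective fun u : ℝ => (!₂[u, 0] : Euc 2) := fun a b hab =>
    congrArg (fun w : Euc 2 => w 0) hab
  rw [ncard_image_of_injective _ hinj]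
  exact ncard_pPoly_eq (by rwa [abs_neg])

theorem isConnected_fMain_fiber {t : ℝ} (ht : |t| < 1 / 4) : IsConnected (fMain ⁻¹' {t}) := by
  obtain ⟨S, hS⟩ := Infinite.exists_subset_card_eq (Euc 2) 3
  have hS' : (S : Set (Euc 2)).ncard = 3 := by rw [ncard_coe_finset, hS]
  obtain ⟨e⟩ := (areDiffeomorphic_fMain_fiber_compl ht hS').nonempty_homeomorph
  have hc : IsConnected (S : Set (Euc 2))ᶜ :=
    S.finite_toSet.countable.isConnected_compl_of_one_lt_rank
      (by rw [← Module.finrank_eq_rank, finrank_euclideanSpace_fin]; norm_num)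
  rw [isConnected_iff_connectedSpace] at hc ⊢
  exact e.symm.surjective.connectedSpace e.symm.continuous

/-! ### Failure of local triviality at `0` -/

/-- Hence `t + p(u) < 0` for `t < 0` and `u < 2`: the puncture at `u = 1` has no counterpart in the
fibers over negative `t`. -/
theorem pPoly_neg {u : ℝ} (hu : u < 2) (hu1 : u ≠ 1) : pPoly u < 0 := by
  have h1 : u - 3 ≠ 0 := by linarith
  have h2 : u - 1 ≠ 0 := sub_ne_zero.2 hu1
  exact mul_neg_of_neg_of_pos (mul_neg_of_pos_of_neg (by positivity) (by linarith)) (by positivity)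

theorem not_isLocallyTrivialFibrationAt_fMain : ¬ IsLocallyTrivialFibrationAt fMain 0 := by
  rintro ⟨U, hU, φ, hφ⟩
  obtain ⟨ε, hε, hεU⟩ := Metric.mem_nhds_iff.1 hU
  have h0U : (0 : ℝ) ∈ U := mem_of_mem_nhds hU
  -- The disc of fibers: the unit circle lies over `0`, the centre over `-ε / 2`.
  let t : ℂ → ℝ := fun w => -(ε / 2) * max 0 (1 - ‖w‖)
  -- This equals `w / 2` on the unit circle and has norm below `1` everywhere, so that `u = 1 + Re
  -- q` stays below `2`. The disc is extended to all of `ℂ` with `t = 0` outside it.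
  let q : ℂ → ℂ := fun w => w / ((1 + ‖w‖ : ℝ) : ℂ)
  let c : ℂ → Euc 2 := fun w => !₂[1 + (q w).re, (q w).im]
  let K : ℂ → Euc 3 := fun w => fiberChart (t w) (c w)
  have hpos (w : ℂ) : 0 < 1 + ‖w‖ := by positivity
  have ht : Continuous t := by fun_prop
  have hq : Continuous q :=
    continuous_id.div (by fun_prop) fun w => Complex.ofReal_ne_zero.2 (hpos w).ne'
  have htU (w : ℂ) : t w ∈ U := by
    refine hεU ?_
    have h1 : 0 ≤ max 0 (1 - ‖w‖) := le_max_left _ _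
    have h2 : max 0 (1 - ‖w‖) ≤ 1 := max_le zero_le_one (by linarith [norm_nonneg w])
    rw [mem_ball_zero_iff, Real.norm_eq_abs, abs_lt]
    constructor <;> simp only [t] <;> nlinarith
  -- The disc avoids the punctures: since `t ≤ 0` and `u < 2`, hitting one forces `u = 1` and hence
  -- `w = 0`, but there `t = -ε / 2` while `p(1) = 0`.
  have hne (w : ℂ) : (t w + pPoly (1 + (q w).re)) ^ 2 + (q w).im ^ 2 ≠ 0 := by
    intro h
    have h1 : t w + pPoly (1 + (q w).re) = 0 := by
      nlinarith [sq_nonneg (t w + pPoly (1 + (q w).re)), sq_nonneg (q w).im]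
    have h2 : (q w).im = 0 := by
      nlinarith [sq_nonneg (t w + pPoly (1 + (q w).re)), sq_nonneg (q w).im]
    have h3 : (q w).re < 1 := by
      refine ((Complex.re_le_norm _).trans_lt ?_)
      rw [norm_div, Complex.norm_real, Real.norm_of_nonneg (hpos w).le, div_lt_one (hpos w)]
      linarith
    have ht0 : t w ≤ 0 := by
      have h1 : 0 ≤ max 0 (1 - ‖w‖) := le_max_left _ _
      simp only [t]
      nlinarith
    by_cases h4 : (q w).re = 0
    · have h5 : q w = 0 := Complex.ext h4 h2
      have hw : w = 0 := by
        simpa [q, ← Complex.ofReal_one, ← Complex.ofReal_add, (hpos w).ne'] using h5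
      subst hw
      norm_num [q, t, pPoly] at h1
      linarith
    · linarith [pPoly_neg (u := 1 + (q w).re) (by linarith) (by simpa using h4)]
  have hK : Continuous K := by
    refine (PiLp.continuous_toLp 2 _).comp (continuous_pi fun i => ?_)
    have hp := contDiff_pPoly.continuous
    fin_cases i
    · exact Continuous.div (by simp [c]; fun_prop) (by simp [c]; fun_prop)
        (fun w => by simpa [c] using hne w)
    · simp [c]; fun_prop
    · simp [c]; fun_prop
  have hfK (w : ℂ) : fMain (K w) = t w := fMain_fiberChart (by simpa [c] using hne w)
  -- The retraction of `f ⁻¹ U` onto the fiber over `0` that `φ` provides.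
  let R : ℂ → Euc 3 := fun w =>
    φ ((φ.symm ⟨K w, by rw [mem_preimage, hfK]; exact htU w⟩).1, ⟨0, h0U⟩)
  have hR : Continuous R := by fun_prop
  have hfR (w : ℂ) : fMain (R w) = 0 := hφ _
  have hRK {w : ℂ} (hw : ‖w‖ = 1) : R w = K w := by
    have hmem : K w ∈ fMain ⁻¹' U := by rw [mem_preimage, hfK]; exact htU w
    have h2 : (φ.symm ⟨K w, hmem⟩).2 = ⟨0, h0U⟩ := by
      apply Subtype.ext
      rw [← hφ, φ.apply_symm_apply]
      simp [hfK, t, hw]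
    simp only [R]
    rw [← h2, Prod.mk.eta, φ.apply_symm_apply]
  -- `F` is `(u - 1) + iz` along `R`. A zero would be a point of the zero fiber with `u = 1`, `z =
  -- 0`, hence `y = p(1) = 0`, which forces `u = 0`.
  let F : ℂ → ℂ := fun w =>
    ((R w 0 * (R w 1 ^ 2 + R w 2 ^ 2) - 1 : ℝ) : ℂ) + (R w 2 : ℂ) * Complex.I
  have hF : Continuous F := by fun_prop
  have hF0 (w : ℂ) : F w ≠ 0 := by
    intro h
    have h1 : R w 0 * (R w 1 ^ 2 + R w 2 ^ 2) - 1 = 0 := by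
      simpa [F, -Complex.ofReal_sub, -Complex.ofReal_mul] using congrArg Complex.re h
    have h2 : R w 2 = 0 := by
      simpa [F, -Complex.ofReal_sub, -Complex.ofReal_mul] using congrArg Complex.im h
    have h3 := hfR w
    rw [fMain, sub_eq_zero.1 h1] at h3
    norm_num [pPoly] at h3
    simp [h2, h3] at h1
  obtain ⟨w, hw, hFw⟩ := exists_norm_eq_one_ne_mul_of_continuous hF hF0 (1 / 2)
  refine hFw ?_
  have hqw : q w = 1 / 2 * w := by
    simp only [q, hw]
    push_cast
    ring
  rw [← hqw]
  have h0 : K w 0 * (K w 1 ^ 2 + K w 2 ^ 2) = 1 + (q w).re := by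
    simpa [K, fiberChart, c] using div_mul_cancel₀ _ (hne w)
  have h2 : K w 2 = (q w).im := by simp [K, fiberChart, c]
  simp only [F]
  rw [hRK hw, h0, h2, add_sub_cancel_left, Complex.re_add_im]

theorem mainTheorem1 :
    IsPolynomialFunction fMain ∧ IsSubmersionFunction fMain ∧
    (∀ᶠ t in 𝓝 (0 : ℝ), IsConnected (fMain ⁻¹' {t}) ∧
      ∀ S : Set (Euc 2), S.ncard = 3 → AreDiffeomorphic (fMain ⁻¹' {t}) Sᶜ) ∧
    (0 : ℝ) ∈ bifurcationSet fMain ∧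
    ¬ (∀ (g : Euc 3 → ℝ) (c : ℝ), IsPolynomialFunction g → IsRegularValue g c →
        (∀ᶠ t in 𝓝 c, IsConnected (g ⁻¹' {t})) →
        (∃ χ : ℤ, ∀ᶠ t in 𝓝 c, eulerCharacteristic (g ⁻¹' {t} : Set (Euc 3)) = χ) →
        c ∉ bifurcationSet g) := by
  have hsmall : ∀ᶠ t in 𝓝 (0 : ℝ), |t| < 1 / 4 :=
    continuous_abs.continuousAt.eventually_lt_const (by norm_num)
  refine ⟨isPolynomialFunction_fMain, isSubmersionFunction_fMain,
    hsmall.mono fun t ht => ⟨isConnected_fMain_fiber ht, fun S hS =>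
      areDiffeomorphic_fMain_fiber_compl ht hS⟩,
    not_isLocallyTrivialFibrationAt_fMain, fun H => ?_⟩
  refine H fMain 0 isPolynomialFunction_fMain (fun v _ => isSubmersionFunction_fMain.2 v)
    (hsmall.mono fun t ht => isConnected_fMain_fiber ht)
    ⟨eulerCharacteristic (fMain ⁻¹' {0} : Set (Euc 3)), hsmall.mono fun t ht => ?_⟩
    not_isLocallyTrivialFibrationAt_fMain
  -- Both fibers are diffeomorphic to the complement of the same three points, so the Euler
  -- characteristic is constant without being computed.
  obtain ⟨S, hS⟩ := Infinite.exists_subset_card_eq (Euc 2) 3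
  have hS' : (S : Set (Euc 2)).ncard = 3 := by rw [ncard_coe_finset, hS]
  obtain ⟨e⟩ := ((areDiffeomorphic_fMain_fiber_compl ht hS').trans
    (areDiffeomorphic_fMain_fiber_compl (t := 0) (by norm_num) hS').symm).nonempty_homeomorph
  exact eulerCharacteristic_eq_of_homeomorph e
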